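/- Let $1<p<2$ and let $\aleph$ be an uncountable cardinal. For a cardinal $\aleph'$, call a Banach space an $L_p(\aleph')$ space if it is (linearly) isometric to an $\ell_p$-sum $\left(\sum_{\alpha\in\Gamma} L_p(\mu_\alpha)\right)_p$ with $|\Gamma|\le\aleph'$ and each $\mu_\alpha$ a finite measure. If $\aleph'<\aleph$, then $\ell_p(\aleph)$ is not isomorphic (linearly homeomorphic) to a subspace of any $L_p(\aleph')$ space. (The scalars may be real or complex.) -/

import Mathlib

open MeasureTheory
open scoped ENNReal Cardinal

universe u v w x y

/-- `E` embeds isomorphically into `F`: `E` is linearly homeomorphic to a linear subspace of `F`. -/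
def EmbedsIsomorphically (𝕜 : Type y) [RCLike 𝕜] (E : Type v) (F : Type x)
    [NormedAddCommGroup E] [NormedSpace 𝕜 E] [NormedAddCommGroup F] [NormedSpace 𝕜 F] : Prop :=
  ∃ Y : Submodule 𝕜 F, Nonempty (E ≃L[𝕜] Y)

/-- `X` is an `L_p(κ)` space: it is linearly isometric to the `ℓ_p`-sum `(∑_{a ∈ Γ} L_p(μ_a))_p`
for some index set `Γ` of cardinality at most `κ` and some finite measures `μ_a`. -/
def IsLpCardSpace (𝕜 : Type y) [RCLike 𝕜] (p : ℝ≥0∞) [Fact (1 ≤ p)] (κ : Cardinal.{u})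
    (X : Type x) [NormedAddCommGroup X] [NormedSpace 𝕜 X] : Prop :=
  ∃ (Γ : Type u) (Ω : Γ → Type w) (_ : ∀ a, MeasurableSpace (Ω a)) (μ : ∀ a, Measure (Ω a)),
    #Γ ≤ κ ∧ (∀ a, IsFiniteMeasure (μ a)) ∧
      Nonempty (X ≃ₗᵢ[𝕜] lp (fun a => Lp 𝕜 p (μ a)) p)

/-! An isomorphism `T` from `ℓ_p(κ)` forces `N` to be at most a constant times `‖∑ ± T e_i‖ ^ p` for
any `N` unit vectors and any signs. Approximate each `T e_i` within `ε` by a square integrable `g_i`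
supported on finitely many summands. There are fewer than `κ` pairs (finite support, integer bound
on the square integral), so infinitely many `i` share one pair.

On these, `p < 2` gives a contradiction: for suitable signs the square integral of `∑ ± g_i` grows
at most linearly in `N`. On a fixed finite measure, `t ^ p ≤ B + l * t ^ 2` with `l` small then
bounds its `p`-th power integral by `ε N + O(1)`. By type `p`, the errors also contribute at most a
multiple of `ε N`. For `ε` small and `N` large this violates the lower bound. -/

/-- The two-point form of "a Hilbert space has type `r` with constant one" for `0 < r ≤ 2`. -/
theorem norm_add_rpow_add_norm_sub_rpow_le {𝕜 E : Type*} [RCLike 𝕜] [NormedAddCommGroup E]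
    [InnerProductSpace 𝕜 E] {r : ℝ} (hr₀ : 0 < r) (hr₂ : r ≤ 2) (z w : E) :
    ‖z + w‖ₑ ^ r + ‖z - w‖ₑ ^ r ≤ 2 * (‖z‖ₑ ^ r + ‖w‖ₑ ^ r) := by
  have key : ‖z + w‖₊ ^ r + ‖z - w‖₊ ^ r ≤ 2 * (‖z‖₊ ^ r + ‖w‖₊ ^ r) := by
    have hs : 0 ≤ r / 2 := by positivity
    have hs1 : r / 2 ≤ 1 := by linarith
    have hpow (t : NNReal) : t ^ r = (t ^ 2) ^ (r / 2) := by
      rw [← NNReal.rpow_natCast, ← NNReal.rpow_mul]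
      congr 1
      push_cast
      ring
    have hpar : ‖z + w‖₊ ^ 2 + ‖z - w‖₊ ^ 2 = 2 * (‖z‖₊ ^ 2 + ‖w‖₊ ^ 2) := by
      apply NNReal.eq
      have := parallelogram_law_with_norm 𝕜 z w
      push_cast
      linarith
    -- Midpoint concavity of `t ^ (r / 2)` at the two squared norms; the parallelogram law evaluates
    -- the midpoint.
    have hconc := And.right (NNReal.concaveOn_rpow hs hs1) (Set.mem_univ (‖z + w‖₊ ^ 2))
      (Set.mem_univ (‖z - w‖₊ ^ 2)) (zero_le (a := (1 / 2 : NNReal)))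
      (zero_le (a := (1 / 2 : NNReal))) (add_halves 1)
    simp only [smul_eq_mul] at hconc
    have hmid : (1 / 2 : NNReal) * ‖z + w‖₊ ^ 2 + 1 / 2 * ‖z - w‖₊ ^ 2 = ‖z‖₊ ^ 2 + ‖w‖₊ ^ 2 := by
      rw [← mul_add, hpar, ← mul_assoc]
      norm_num
    rw [hmid, ← mul_add] at hconc
    rw [hpow ‖z + w‖₊, hpow ‖z - w‖₊, hpow ‖z‖₊, hpow ‖w‖₊]
    calc (‖z + w‖₊ ^ 2) ^ (r / 2) + (‖z - w‖₊ ^ 2) ^ (r / 2)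
        = 2 * (1 / 2 * ((‖z + w‖₊ ^ 2) ^ (r / 2) + (‖z - w‖₊ ^ 2) ^ (r / 2))) := by
          rw [← mul_assoc]; norm_num
      _ ≤ 2 * (‖z‖₊ ^ 2 + ‖w‖₊ ^ 2) ^ (r / 2) := by gcongr
      _ ≤ _ := by
          gcongr
          exact NNReal.rpow_add_le_add_rpow _ _ hs hs1
  simp only [enorm_eq_nnnorm, ← ENNReal.coe_rpow_of_nonneg _ hr₀.le]
  exact_mod_cast key

/-- If `A` has type one in the two-point sense, signs can be chosen greedily. -/
theorem exists_signs_apply_sum_le {V ι : Type*} [AddCommGroup V] (A : V → ℝ≥0∞) (hA0 : A 0 = 0)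
    (hA : ∀ x y, A (x + y) + A (x - y) ≤ 2 * (A x + A y)) (v : ι → V) (S : Finset ι) :
    ∃ s : ι → ℤ, (∀ i, s i = 1 ∨ s i = -1) ∧ A (∑ i ∈ S, s i • v i) ≤ ∑ i ∈ S, A (v i) := by
  classical
  induction S using Finset.induction_on with
  | empty => exact ⟨fun _ => 1, fun _ => Or.inl rfl, by simp [hA0]⟩
  | insert j S hj ih =>
    obtain ⟨s, hs, hle⟩ := ih
    have hupd (c : ℤ) : ∑ i ∈ insert j S, Function.update s j c i • v i
        = (∑ i ∈ S, s i • v i) + c • v j := by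
      rw [Finset.sum_insert hj, Function.update_self, add_comm]
      congr 1
      refine Finset.sum_congr rfl fun i hi => ?_
      rw [Function.update_of_ne (ne_of_mem_of_not_mem hi hj)]
    have hmem (c : ℤ) (hc : c = 1 ∨ c = -1) (i : ι) :
        Function.update s j c i = 1 ∨ Function.update s j c i = -1 := by
      by_cases h : i = j
      · subst h; simpa using hc
      · simpa [h] using hs i
    set x := ∑ i ∈ S, s i • v i
    -- The smaller of the two values is at most their average.
    have hor : A (x + v j) ≤ A x + A (v j) ∨ A (x - v j) ≤ A x + A (v j) := by
      by_contra! h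
      have := ENNReal.add_lt_add h.1 h.2
      rw [← two_mul] at this
      exact absurd (hA x (v j)) this.not_ge
    have hsum : A x + A (v j) ≤ ∑ i ∈ insert j S, A (v i) := by
      rw [Finset.sum_insert hj, add_comm]
      gcongr
    rcases hor with h | h
    · refine ⟨Function.update s j 1, hmem 1 (Or.inl rfl), ?_⟩
      rw [hupd, one_smul]
      exact h.trans hsum
    · refine ⟨Function.update s j (-1), hmem (-1) (Or.inr rfl), ?_⟩
      rw [hupd, neg_one_smul, ← sub_eq_add_neg]
      exact h.trans hsum

/-- A power with a smaller exponent is dominated by a constant plus a small multiple of a power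
with a larger exponent. -/
theorem ENNReal.exists_rpow_le_add_mul_rpow {p q : ℝ} (hp : 0 < p) (hpq : p < q) {l : ℝ≥0∞}
    (hl : l ≠ 0) : ∃ B : ℝ≥0∞, B ≠ ⊤ ∧ ∀ t : ℝ≥0∞, t ^ p ≤ B + l * t ^ q := by
  have hd : 0 < q - p := sub_pos.2 hpq
  -- Beyond `M` the factor `l * t ^ (q - p)` is at least one; below it `M ^ p` suffices. The minimum
  -- with one covers `l = ⊤`.
  set M : ℝ≥0∞ := (min l 1)⁻¹ ^ (q - p)⁻¹ with hM
  have hl' : min l 1 ≠ 0 := by simp [hl]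
  have hMtop : M ≠ ⊤ := ENNReal.rpow_ne_top_of_nonneg (by positivity) (ENNReal.inv_ne_top.2 hl')
  refine ⟨M ^ p, ENNReal.rpow_ne_top_of_nonneg hp.le hMtop, fun t => ?_⟩
  rcases le_total t M with h | h
  · exact (ENNReal.rpow_le_rpow h hp.le).trans le_self_add
  · refine le_trans ?_ le_add_self
    have h1 : (min l 1)⁻¹ ≤ t ^ (q - p) := by
      have := ENNReal.rpow_le_rpow h hd.le
      rwa [hM, ← ENNReal.rpow_mul, inv_mul_cancel₀ hd.ne', ENNReal.rpow_one] at this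
    have h2 : 1 ≤ l * t ^ (q - p) := by
      calc (1 : ℝ≥0∞) = min l 1 * (min l 1)⁻¹ :=
            (ENNReal.mul_inv_cancel hl' (ne_top_of_le_ne_top ENNReal.one_ne_top
              (min_le_right _ _))).symm
        _ ≤ l * t ^ (q - p) := by gcongr; exact min_le_left _ _
    calc t ^ p = 1 * t ^ p := (one_mul _).symm
      _ ≤ l * t ^ (q - p) * t ^ p := by gcongr
      _ = l * t ^ q := by
        rw [mul_assoc, ← ENNReal.rpow_add_of_nonneg _ _ hd.le hp.le, sub_add_cancel]

/-! ### Power integrals on `ℓ_p`-sums of `L_p` spaces. -/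

section PowerIntegral

variable {𝕜 : Type*} [RCLike 𝕜] {Γ : Type*} {Ω : Γ → Type*} [∀ a, MeasurableSpace (Ω a)]
  {μ : ∀ a, Measure (Ω a)} {p : ℝ≥0∞} [Fact (1 ≤ p)]

/-- The sum over all summands of the integrals of `‖v‖ ^ r`, for `v` in an `ℓ_p`-sum of
`L_p` spaces. -/
noncomputable def powerIntegral (r : ℝ) (v : lp (fun a => Lp 𝕜 p (μ a)) p) : ℝ≥0∞ :=
  ∑' a, ∫⁻ x, ‖(v a : Ω a → 𝕜) x‖ₑ ^ r ∂(μ a)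

theorem lintegral_enorm_zero_rpow {Ω 𝕜 : Type*} [RCLike 𝕜] [MeasurableSpace Ω] {μ : Measure Ω}
    {p : ℝ≥0∞} {r : ℝ} (hr : 0 < r) : ∫⁻ x, ‖((0 : Lp 𝕜 p μ) : Ω → 𝕜) x‖ₑ ^ r ∂μ = 0 := by
  rw [lintegral_congr_ae (g := fun _ => 0), lintegral_zero]
  filter_upwards [Lp.coeFn_zero 𝕜 p μ] with x hx
  rw [hx, Pi.zero_apply, enorm_zero, ENNReal.zero_rpow_of_pos hr]

theorem powerIntegral_zero {r : ℝ} (hr : 0 < r) :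
    powerIntegral r (0 : lp (fun a => Lp 𝕜 p (μ a)) p) = 0 := by
  simp only [powerIntegral, lp.coeFn_zero, Pi.zero_apply, lintegral_enorm_zero_rpow hr, tsum_zero]

theorem aemeasurable_enorm_rpow {Ω 𝕜 : Type*} [RCLike 𝕜] [MeasurableSpace Ω] {μ : Measure Ω}
    {p : ℝ≥0∞} (r : ℝ) (f : Lp 𝕜 p μ) : AEMeasurable (fun x => ‖(f : Ω → 𝕜) x‖ₑ ^ r) μ :=
  (Lp.aestronglyMeasurable f).enorm.pow_const r

theorem powerIntegral_add_add_sub_le {r : ℝ} (hr₀ : 0 < r) (hr₂ : r ≤ 2)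
    (v w : lp (fun a => Lp 𝕜 p (μ a)) p) :
    powerIntegral r (v + w) + powerIntegral r (v - w)
      ≤ 2 * (powerIntegral r v + powerIntegral r w) := by
  unfold powerIntegral
  rw [← ENNReal.tsum_add, ← ENNReal.tsum_add, ← ENNReal.tsum_mul_left]
  refine ENNReal.tsum_le_tsum fun a => ?_
  rw [← lintegral_add_left' (aemeasurable_enorm_rpow r _),
    ← lintegral_add_left' (aemeasurable_enorm_rpow r _), ← lintegral_const_mul' _ _ (by simp)]
  refine lintegral_mono_ae ?_
  simp only [lp.coeFn_add, lp.coeFn_sub, Pi.add_apply, Pi.sub_apply]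
  filter_upwards [Lp.coeFn_add (v a) (w a), Lp.coeFn_sub (v a) (w a)] with x h₁ h₂
  rw [h₁, h₂]
  exact norm_add_rpow_add_norm_sub_rpow_le (𝕜 := 𝕜) hr₀ hr₂ _ _

theorem powerIntegral_add_le {r : ℝ} (hr₀ : 0 < r) (hr₂ : r ≤ 2)
    (v w : lp (fun a => Lp 𝕜 p (μ a)) p) :
    powerIntegral r (v + w) ≤ 2 * (powerIntegral r v + powerIntegral r w) :=
  le_self_add.trans (powerIntegral_add_add_sub_le hr₀ hr₂ v w)

theorem powerIntegral_toReal (hp : p ≠ ⊤) (v : lp (fun a => Lp 𝕜 p (μ a)) p) :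
    powerIntegral p.toReal v = ‖v‖ₑ ^ p.toReal := by
  have hp₀ : p ≠ 0 := (zero_lt_one.trans_le (Fact.out : 1 ≤ p)).ne'
  have hpos : 0 < p.toReal := ENNReal.toReal_pos hp₀ hp
  rw [← ofReal_norm, ENNReal.ofReal_rpow_of_nonneg (norm_nonneg _) hpos.le,
    lp.norm_rpow_eq_tsum hpos, ENNReal.ofReal_tsum_of_nonneg (fun _ => by positivity)
      ((lp.memℓp v).summable hpos)]
  refine tsum_congr fun a => ?_
  rw [← ENNReal.ofReal_rpow_of_nonneg (norm_nonneg _) hpos.le, ofReal_norm,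
    Lp.enorm_def, eLpNorm_eq_lintegral_rpow_enorm_toReal hp₀ hp, ← ENNReal.rpow_mul,
    one_div_mul_cancel hpos.ne', ENNReal.rpow_one]

/-- Integrating the pointwise bound over the summands in `F` costs `B` times their total measure, a
constant independent of `v`. -/
theorem powerIntegral_le_of_support_subset {r q : ℝ} (hr : 0 < r) {B l : ℝ≥0∞} (hl : l ≠ ⊤)
    (hB : ∀ t : ℝ≥0∞, t ^ r ≤ B + l * t ^ q) (F : Finset Γ)
    (v : lp (fun a => Lp 𝕜 p (μ a)) p) (hv : ∀ a ∉ F, v a = 0) :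
    powerIntegral r v ≤ B * ∑ a ∈ F, μ a Set.univ + l * powerIntegral q v := by
  unfold powerIntegral
  rw [tsum_eq_sum (s := F) fun a ha => by rw [hv a ha]; exact lintegral_enorm_zero_rpow hr]
  calc ∑ a ∈ F, ∫⁻ x, ‖(v a : Ω a → 𝕜) x‖ₑ ^ r ∂(μ a)
      ≤ ∑ a ∈ F, (B * μ a Set.univ + l * ∫⁻ x, ‖(v a : Ω a → 𝕜) x‖ₑ ^ q ∂(μ a)) := by
        refine Finset.sum_le_sum fun a _ => ?_
        rw [← lintegral_const, ← lintegral_const_mul' _ _ hl,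
          ← lintegral_add_left measurable_const]
        exact lintegral_mono fun x => hB _
    _ ≤ _ := by
        rw [Finset.sum_add_distrib, Finset.mul_sum, ← Finset.mul_sum (f := fun a =>
          ∫⁻ x, ‖(v a : Ω a → 𝕜) x‖ₑ ^ q ∂(μ a))]
        gcongr
        exact ENNReal.sum_le_tsum F

/-- The elements of an `ℓ_p`-sum of `L_p` spaces that have finite support and are square
integrable. -/
def finiteSupportSquareIntegrable (𝕜 : Type*) [RCLike 𝕜] (μ : ∀ a, Measure (Ω a)) (p : ℝ≥0∞)
    [Fact (1 ≤ p)] : AddSubmonoid (lp (fun a => Lp 𝕜 p (μ a)) p) where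
  carrier := {v | (∃ F : Finset Γ, ∀ a ∉ F, v a = 0) ∧ powerIntegral 2 v ≠ ⊤}
  zero_mem' := ⟨⟨∅, fun _ _ => rfl⟩, by simp [powerIntegral_zero]⟩
  add_mem' := by
    classical
    rintro v w ⟨⟨F, hF⟩, hv⟩ ⟨⟨G, hG⟩, hw⟩
    refine ⟨⟨F ∪ G, fun a ha => ?_⟩, ?_⟩
    · rw [Finset.notMem_union] at ha
      rw [lp.coeFn_add, Pi.add_apply, hF a ha.1, hG a ha.2, add_zero]
    · exact ne_top_of_le_ne_top (by finiteness) (powerIntegral_add_le two_pos le_rfl v w)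

theorem single_mem_finiteSupportSquareIntegrable [DecidableEq Γ] [∀ a, IsFiniteMeasure (μ a)]
    (a : Γ) (f : SimpleFunc (Ω a) 𝕜) (hf : MemLp f p (μ a)) :
    lp.single p a (hf.toLp f) ∈ finiteSupportSquareIntegrable 𝕜 μ p := by
  refine ⟨⟨{a}, fun b hb => lp.single_apply_ne p a _ (by simpa using hb)⟩, ?_⟩
  rw [powerIntegral, tsum_eq_single a fun b hb => by
    rw [lp.single_apply_ne p a _ hb]; exact lintegral_enorm_zero_rpow two_pos,
    lp.single_apply_self]
  have hae : (fun x => ‖(hf.toLp f : Ω a → 𝕜) x‖ₑ ^ (2 : ℝ)) =ᵐ[μ a] fun x => ‖f x‖ₑ ^ (2 : ℝ) := by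
    filter_upwards [hf.coeFn_toLp] with x hx
    rw [hx]
  rw [lintegral_congr_ae hae]
  have h2 : MemLp f 2 (μ a) := f.memLp_of_isFiniteMeasure 2 (μ a)
  have := lintegral_rpow_enorm_lt_top_of_eLpNorm_lt_top two_ne_zero (by simp) h2.2
  simpa using this.ne

/-- Simple functions are dense in each `L_p(μ_a)` and square integrable because `μ_a` is finite;
finite sums of single coordinates are dense in the `ℓ_p`-sum. -/
theorem dense_finiteSupportSquareIntegrable [∀ a, IsFiniteMeasure (μ a)] (hp : p ≠ ⊤) :
    Dense (finiteSupportSquareIntegrable 𝕜 μ p : Set (lp (fun a => Lp 𝕜 p (μ a)) p)) := by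
  classical
  set D := finiteSupportSquareIntegrable 𝕜 μ p
  have hsingle (a : Γ) (f : Lp 𝕜 p (μ a)) : lp.single p a f ∈ D.topologicalClosure := by
    have hd : f ∈ closure (Set.range fun g : Lp.simpleFunc 𝕜 p (μ a) => (g : Lp 𝕜 p (μ a))) :=
      Lp.simpleFunc.denseRange hp f
    refine map_mem_closure (lp.isometry_single (p := p) (E := fun a => Lp 𝕜 p (μ a)) a).continuous
      hd ?_
    rintro _ ⟨g, rfl⟩
    have := single_mem_finiteSupportSquareIntegrable (p := p) (μ := μ) a
      (Lp.simpleFunc.toSimpleFunc g) (Lp.simpleFunc.memLp g)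
    have e : (Lp.simpleFunc.memLp g).toLp (Lp.simpleFunc.toSimpleFunc g) = (g : Lp 𝕜 p (μ a)) :=
      congrArg Subtype.val (Lp.simpleFunc.toLp_toSimpleFunc g)
    rwa [e] at this
  intro f
  exact D.isClosed_topologicalClosure.mem_of_tendsto (lp.hasSum_single hp f)
    (Filter.Eventually.of_forall fun s => AddSubmonoid.sum_mem _ fun a _ => hsingle a (f a))

/-- A family in an `ℓ_p`-sum of `L_p` spaces that is uniformly close to a family with common
finite support and bounded square integrals has signed sums that grow slowly. -/
theorem exists_signs_powerIntegral_sum_le {ι : Type*} [∀ a, IsFiniteMeasure (μ a)] (hp₂ : p < 2)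
    {ε : ℝ≥0∞} (hε : ε ≠ 0) (hε' : ε ≠ ⊤) (F : Finset Γ) {C : ℝ≥0∞} (hC : C ≠ ⊤) :
    ∃ R : ℝ≥0∞, R ≠ ⊤ ∧ ∀ (S : Finset ι) (f g : ι → lp (fun a => Lp 𝕜 p (μ a)) p),
      (∀ i ∈ S, ∀ a ∉ F, g i a = 0) → (∀ i ∈ S, powerIntegral 2 (g i) ≤ C) →
      (∀ i ∈ S, powerIntegral p.toReal (f i - g i) ≤ ε) →
      ∃ s : ι → ℤ, (∀ i, s i = 1 ∨ s i = -1) ∧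
        powerIntegral p.toReal (∑ i ∈ S, s i • f i) ≤ 4 * S.card * ε + R := by
  have hp₀ : p ≠ 0 := (zero_lt_one.trans_le (Fact.out : 1 ≤ p)).ne'
  have hpos : 0 < p.toReal := ENNReal.toReal_pos hp₀ hp₂.ne_top
  have hlt : p.toReal < 2 := by
    simpa using ENNReal.toReal_strict_mono (by simp) hp₂
  have hC1 : C + 1 ≠ ⊤ := by finiteness
  -- Chosen so that `l * C ≤ ε`; the added one avoids dividing by zero.
  set l : ℝ≥0∞ := ε / (C + 1) with hl_def
  have hl : l ≠ 0 := ENNReal.div_ne_zero.2 ⟨hε, hC1⟩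
  have hl' : l ≠ ⊤ := ENNReal.div_ne_top hε' (by simp)
  have hlC : l * C ≤ ε := calc
    l * C ≤ l * (C + 1) := by gcongr; exact le_self_add
    _ = ε := ENNReal.div_mul_cancel (by simp) hC1
  obtain ⟨B, hB, hBl⟩ := ENNReal.exists_rpow_le_add_mul_rpow hpos hlt hl
  set m := ∑ a ∈ F, μ a Set.univ
  have hm : m ≠ ⊤ := ENNReal.sum_ne_top.2 fun a _ => measure_ne_top _ _
  refine ⟨2 * (B * m), by finiteness, fun S f g hgF hgC hfg => ?_⟩
  let V := lp (fun a => Lp 𝕜 p (μ a)) p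
  -- One functional on pairs, so that the same signs control both the errors and the approximants.
  let A : V × V → ℝ≥0∞ := fun x => powerIntegral p.toReal x.1 + l * powerIntegral 2 x.2
  obtain ⟨s, hs, hle⟩ := exists_signs_apply_sum_le A
    (by simp [A, powerIntegral_zero hpos, powerIntegral_zero two_pos])
    (fun x y => calc
      A (x + y) + A (x - y) = (powerIntegral p.toReal (x.1 + y.1) +
            powerIntegral p.toReal (x.1 - y.1)) +
          l * (powerIntegral 2 (x.2 + y.2) + powerIntegral 2 (x.2 - y.2)) := by
        simp only [A, Prod.fst_add, Prod.snd_add, Prod.fst_sub, Prod.snd_sub]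
        ring
      _ ≤ 2 * (powerIntegral p.toReal x.1 + powerIntegral p.toReal y.1) +
          l * (2 * (powerIntegral 2 x.2 + powerIntegral 2 y.2)) := by
        gcongr
        · exact powerIntegral_add_add_sub_le hpos hlt.le _ _
        · exact powerIntegral_add_add_sub_le two_pos le_rfl _ _
      _ = 2 * (A x + A y) := by
        simp only [A]
        ring)
    (fun i => (f i - g i, g i)) S
  refine ⟨s, hs, ?_⟩
  set H : V := ∑ i ∈ S, s i • (f i - g i) with hH
  set G : V := ∑ i ∈ S, s i • g i with hG
  have hHG : ∑ i ∈ S, s i • f i = H + G := by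
    rw [hH, hG, ← Finset.sum_add_distrib]
    exact Finset.sum_congr rfl fun i _ => by rw [← smul_add, sub_add_cancel]
  have hAHG : ∑ i ∈ S, s i • ((f i - g i, g i) : V × V) = (H, G) := by
    ext1
    · simp [Prod.fst_sum, hH]
    · simp [Prod.snd_sum, hG]
  have hGF : ∀ a ∉ F, G a = 0 := fun a ha => by
    rw [hG, lp.coeFn_sum, Finset.sum_apply]
    refine Finset.sum_eq_zero fun i hi => ?_
    have : (s i • g i) a = s i • g i a := by
      rcases hs i with h | h <;> simp [h]
    rw [this, hgF i hi a ha, smul_zero]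
  have hsum : ∑ i ∈ S, A (f i - g i, g i) ≤ S.card * (2 * ε) := by
    rw [← nsmul_eq_mul]
    refine Finset.sum_le_card_nsmul _ _ _ fun i hi => ?_
    rw [two_mul]
    exact add_le_add (hfg i hi) ((mul_le_mul_right (hgC i hi) l).trans hlC)
  rw [hAHG] at hle
  calc powerIntegral p.toReal (∑ i ∈ S, s i • f i)
      ≤ 2 * (powerIntegral p.toReal H + powerIntegral p.toReal G) := by
        rw [hHG]; exact powerIntegral_add_le hpos hlt.le _ _
    _ ≤ 2 * (powerIntegral p.toReal H + (B * m + l * powerIntegral 2 G)) := by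
        gcongr
        exact powerIntegral_le_of_support_subset hpos hl' hBl F G hGF
    _ = 2 * A (H, G) + 2 * (B * m) := by
        simp only [A]
        ring
    _ ≤ 2 * (S.card * (2 * ε)) + 2 * (B * m) := by
        gcongr
        exact hle.trans hsum
    _ = 4 * S.card * ε + 2 * (B * m) := by ring

end PowerIntegral

/-! ### Unit vectors, cardinal counting and the contradiction. -/

theorem enorm_sum_zsmul_single_rpow {𝕜 ι : Type*} [RCLike 𝕜] [DecidableEq ι] {p : ℝ≥0∞}
    [Fact (1 ≤ p)] (hp : p ≠ ⊤) (S : Finset ι) {s : ι → ℤ} (hs : ∀ i, s i = 1 ∨ s i = -1) :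
    ‖∑ i ∈ S, s i • (lp.single p i (1 : 𝕜) : lp (fun _ : ι => 𝕜) p)‖ₑ ^ p.toReal = S.card := by
  have hpos : 0 < p.toReal :=
    ENNReal.toReal_pos (zero_lt_one.trans_le (Fact.out : 1 ≤ p)).ne' hp
  have h1 (i : ι) : s i • (lp.single p i (1 : 𝕜) : lp (fun _ : ι => 𝕜) p)
      = lp.single p i (s i : 𝕜) := by
    rcases hs i with h | h
    · rw [h, one_smul, Int.cast_one]
    · rw [h, neg_one_smul, ← lp.single_neg, Int.cast_neg, Int.cast_one]
  have h2 (i : ι) : ‖(s i : 𝕜)‖ = 1 := by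
    rcases hs i with h | h <;> simp [h]
  have := lp.norm_sum_single hpos (fun i => (s i : 𝕜)) S
  simp only [h2, Real.one_rpow, Finset.sum_const, nsmul_eq_mul, mul_one] at this
  rw [Finset.sum_congr rfl fun i _ => h1 i, ← ofReal_norm,
    ENNReal.ofReal_rpow_of_nonneg (norm_nonneg _) hpos.le, this, ENNReal.ofReal_natCast]

theorem mk_finset_prod_nat_lt {Γ : Type u} {κ κ' : Cardinal.{u}} (hκ : ℵ₀ < κ) (hκ' : κ' < κ)
    (hΓ : #Γ ≤ κ') : #(Finset Γ × ℕ) < κ := by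
  have hF : #(Finset Γ) < κ := by
    -- An infinite `Γ` has only `#Γ` finite subsets; for finite `Γ`, as for the factor `ℕ`,
    -- uncountability of `κ` is what is needed.
    cases finite_or_infinite Γ
    · exact (Cardinal.lt_aleph0_of_finite _).trans hκ
    · rw [Cardinal.mk_finset_of_infinite]
      exact hΓ.trans_lt hκ'
  rw [Cardinal.mk_prod, Cardinal.lift_id', Cardinal.mk_nat, Cardinal.lift_aleph0]
  exact Cardinal.mul_lt_of_lt hκ.le hF hκ

/-- An `ℓ_p`-sum of at most `κ'` spaces `L_p(μ_a)` with `μ_a` finite does not admit an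
antilipschitz linear map from `ℓ_p(κ)`. -/
theorem not_antilipschitz_lp_sum_Lp {𝕜 : Type*} [RCLike 𝕜] {p : ℝ≥0∞} [Fact (1 ≤ p)] (hp₂ : p < 2)
    {κ κ' : Cardinal.{u}} (hκ : ℵ₀ < κ) (hκ' : κ' < κ) {ι : Type u} (hι : #ι = κ)
    {Γ : Type u} (hΓ : #Γ ≤ κ') {Ω : Γ → Type*} [∀ a, MeasurableSpace (Ω a)]
    {μ : ∀ a, Measure (Ω a)} [∀ a, IsFiniteMeasure (μ a)]
    (T : lp (fun _ : ι => 𝕜) p →ₗ[𝕜] lp (fun a => Lp 𝕜 p (μ a)) p) (K : NNReal) :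
    ¬ AntilipschitzWith K T := by
  classical
  intro hT
  have hp : p ≠ ⊤ := hp₂.ne_top
  have hpos : 0 < p.toReal :=
    ENNReal.toReal_pos (zero_lt_one.trans_le (Fact.out : 1 ≤ p)).ne' hp
  set k : ℝ≥0∞ := (K : ℝ≥0∞) ^ p.toReal with hk_def
  have hk : k ≠ ⊤ := ENNReal.rpow_ne_top_of_nonneg hpos.le ENNReal.coe_ne_top
  -- Makes the linear term `k * 4 * N * ε` at most `N / 2`, so it can be absorbed on the left.
  set ε : ℝ≥0∞ := (8 * (k + 1))⁻¹ with hε_def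
  have hk8 : 8 * (k + 1) ≠ ⊤ := by finiteness
  have hε : ε ≠ 0 := ENNReal.inv_ne_zero.2 hk8
  have hε' : ε ≠ ⊤ := ENNReal.inv_ne_top.2 (by simp)
  have hkε : 2 * (k * (4 * ε)) ≤ 1 := calc
    2 * (k * (4 * ε)) = 8 * k * ε := by ring
    _ ≤ 8 * (k + 1) * ε := by gcongr; exact le_self_add
    _ = 1 := ENNReal.mul_inv_cancel (by simp) hk8
  let e (i : ι) : lp (fun _ : ι => 𝕜) p := lp.single p i (1 : 𝕜)
  have happrox (i : ι) : ∃ g : lp (fun a => Lp 𝕜 p (μ a)) p, ∃ q : Finset Γ × ℕ,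
      (∀ a ∉ q.1, g a = 0) ∧ powerIntegral 2 g ≤ q.2 ∧
        powerIntegral p.toReal (T (e i) - g) ≤ ε := by
    obtain ⟨g, ⟨⟨F, hF⟩, hg⟩, hlt⟩ := EMetric.mem_closure_iff.1
      (dense_finiteSupportSquareIntegrable (𝕜 := 𝕜) (μ := μ) hp (T (e i)))
      (ε ^ p.toReal⁻¹) (ENNReal.rpow_pos (pos_iff_ne_zero.2 hε) hε')
    obtain ⟨n, hn⟩ := ENNReal.exists_nat_gt hg
    refine ⟨g, (F, n), hF, hn.le, ?_⟩
    rw [powerIntegral_toReal hp, ← edist_eq_enorm_sub]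
    exact (ENNReal.le_rpow_inv_iff hpos).1 hlt.le
  choose g q hgF hg2 hgε using happrox
  have : Infinite ι := Cardinal.infinite_iff.2 (hι ▸ hκ.le)
  obtain ⟨⟨F, n⟩, hinf⟩ := Cardinal.exists_infinite_fiber q
    (hι ▸ mk_finset_prod_nat_lt hκ hκ' hΓ)
  obtain ⟨R, hR, hbound⟩ := exists_signs_powerIntegral_sum_le (𝕜 := 𝕜) (ι := ι) (μ := μ)
    hp₂ hε hε' F (ENNReal.natCast_ne_top n)
  -- `R` does not depend on the finite set of indices, so `N` may be taken larger than `2 * (k *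
  -- R)`.
  obtain ⟨N, hN⟩ := ENNReal.exists_nat_gt (show 2 * (k * R) ≠ ⊤ by finiteness)
  obtain ⟨S, hSq, hSN⟩ := (Set.infinite_coe_iff.1 hinf).exists_subset_card_eq N
  have hqS (i : ι) (hi : i ∈ S) : q i = (F, n) := hSq hi
  obtain ⟨s, hs, hle⟩ := hbound S (fun i => T (e i)) g
    (fun i hi => by simpa [hqS i hi] using hgF i) (fun i hi => by simpa [hqS i hi] using hg2 i)
    (fun i _ => hgε i)
  have hTs : ∑ i ∈ S, s i • T (e i) = T (∑ i ∈ S, s i • e i) := by simp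
  have hNle : (N : ℝ≥0∞) ≤ N * (k * (4 * ε)) + k * R := calc
    (N : ℝ≥0∞) = ‖∑ i ∈ S, s i • e i‖ₑ ^ p.toReal := by
      rw [enorm_sum_zsmul_single_rpow hp S hs, hSN]
    _ ≤ (K * ‖T (∑ i ∈ S, s i • e i)‖ₑ) ^ p.toReal := by
      gcongr
      simpa using hT (∑ i ∈ S, s i • e i) 0
    _ = k * powerIntegral p.toReal (∑ i ∈ S, s i • T (e i)) := by
      rw [ENNReal.mul_rpow_of_nonneg _ _ hpos.le, hTs, powerIntegral_toReal hp]
    _ ≤ k * (4 * N * ε + R) := by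
      rw [← hSN]; gcongr
    _ = _ := by ring
  have h2N : (N : ℝ≥0∞) + N ≤ N + 2 * (k * R) := calc
    (N : ℝ≥0∞) + N = 2 * N := (two_mul _).symm
    _ ≤ 2 * (N * (k * (4 * ε)) + k * R) := by gcongr
    _ = N * (2 * (k * (4 * ε))) + 2 * (k * R) := by ring
    _ ≤ N * 1 + 2 * (k * R) := by gcongr
    _ = _ := by rw [mul_one]
  exact hN.not_ge ((ENNReal.add_le_add_iff_left (ENNReal.natCast_ne_top N)).1 h2N)

theorem lemma1 {𝕜 : Type y} [RCLike 𝕜] (p : ℝ≥0∞) [Fact (1 ≤ p)] (hp₁ : 1 < p) (hp₂ : p < 2)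
    (κ κ' : Cardinal.{u}) (hκ : ℵ₀ < κ) (hκ' : κ' < κ)
    (ι : Type u) (hι : #ι = κ)
    (X : Type x) [NormedAddCommGroup X] [NormedSpace 𝕜 X]
    (hX : IsLpCardSpace.{u, w, x, y} 𝕜 p κ' X) :
    ¬ EmbedsIsomorphically 𝕜 (lp (fun _ : ι => 𝕜) p) X := by
  rintro ⟨Y, ⟨Ψ⟩⟩
  obtain ⟨Γ, Ω, _, μ, hΓ, hμ, ⟨J⟩⟩ := hX
  let T : lp (fun _ : ι => 𝕜) p →ₗ[𝕜] lp (fun a => Lp 𝕜 p (μ a)) p :=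
    J.toLinearEquiv.toLinearMap ∘ₗ Y.subtype ∘ₗ Ψ.toLinearEquiv.toLinearMap
  have hT := J.isometry.antilipschitz.comp (Y.subtypeₗᵢ.isometry.antilipschitz.comp Ψ.antilipschitz)
  exact not_antilipschitz_lp_sum_Lp hp₂ hκ hκ' hι hΓ T _ hT
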